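/- Let $G$ be a virtually abelian group (that is, $G$ has an abelian subgroup of finite index), let $S\subseteq G$ be a finite set that generates $G$ as a monoid, and let $\omega\colon S\to\{1,2,3,\ldots\}$ be any function assigning a positive integer weight to each generator. The weight of a word $s_1s_2\cdots s_k$ over $S$ is $\omega(s_1)+\cdots+\omega(s_k)$ (the empty word has weight $0$), the weight of an element $g\in G$ is the minimal weight of a word over $S$ representing $g$, and the weight of a conjugacy class is the minimal weight of its elements. For $n\ge 0$ let $c(n)$ be the number of conjugacy classes of $G$ of weight $n$ (a finite number). Then the weighted conjugacy growth series $$\sum_{n=0}^{\infty} c(n)z^n$$ is rational: there are polynomials $p,q$ with integer coefficients, $q\neq 0$, such that the series equals $p(z)/q(z)$. -/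

import Mathlib

/-- A group is virtually abelian if it has an abelian subgroup of finite index. -/
def IsVirtuallyAbelian (G : Type*) [Group G] : Prop :=
  ∃ A : Subgroup G, IsMulCommutative A ∧ A.FiniteIndex

namespace WeightedGrowth

/-- The element of `G` represented by a word over `S`. Words use the letters of `S` only,
not their formal inverses. -/
def wordEval {G : Type*} [Group G] {S : Finset G} (w : List S) : G :=
  (w.map (fun s : S => (s : G))).prod

/-- The weight of a word: the sum of the weights of its letters. -/
def wordWeight {G : Type*} {S : Finset G} (ω : S → ℕ) (w : List S) : ℕ :=
  (w.map ω).sum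

/-- The weight of a group element: the minimal weight of a word over `S` representing it. -/
noncomputable def elementWeight {G : Type*} [Group G] {S : Finset G} (ω : S → ℕ) (g : G) : ℕ :=
  sInf {n : ℕ | ∃ w : List S, wordEval w = g ∧ wordWeight ω w = n}

/-- The weight of a conjugacy class: the minimal weight of its elements. -/
noncomputable def classWeight {G : Type*} [Group G] {S : Finset G} (ω : S → ℕ)
    (c : ConjClasses G) : ℕ :=
  sInf (elementWeight ω '' c.carrier)

/-- The weighted conjugacy growth function: the number of conjugacy classes of weight `n`. -/
noncomputable def conjGrowth {G : Type*} [Group G] {S : Finset G} (ω : S → ℕ) (n : ℕ) : ℕ :=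
  {c : ConjClasses G | classWeight ω c = n}.ncard

/-- The weighted conjugacy growth series. -/
noncomputable def conjGrowthSeries {G : Type*} [Group G] {S : Finset G} (ω : S → ℕ) :
    PowerSeries ℤ :=
  PowerSeries.mk fun n => (conjGrowth ω n : ℤ)

/-- An integral power series is rational if it is a quotient `p / q` of polynomials with
integer coefficients, `q ≠ 0`. -/
def IsRationalSeries (f : PowerSeries ℤ) : Prop :=
  ∃ p q : Polynomial ℤ, q ≠ 0 ∧ (q : PowerSeries ℤ) * f = (p : PowerSeries ℤ)

theorem exists_wordEval_eq {G : Type*} [Group G] {S : Finset G}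
    (hS : Submonoid.closure (S : Set G) = ⊤) (g : G) : ∃ w : List S, wordEval w = g := by
  have hg : g ∈ Submonoid.closure (S : Set G) := by rw [hS]; trivial
  induction hg using Submonoid.closure_induction with
  | mem x hx => exact ⟨[⟨x, hx⟩], by simp [wordEval]⟩
  | one => exact ⟨[], by simp [wordEval]⟩
  | mul x y _ _ ihx ihy =>
    obtain ⟨u, rfl⟩ := ihx
    obtain ⟨v, rfl⟩ := ihy
    exact ⟨u ++ v, by simp [wordEval]⟩

theorem exists_word_classWeight {G : Type*} [Group G] {S : Finset G}
    (hS : Submonoid.closure (S : Set G) = ⊤) (ω : S → ℕ) (c : ConjClasses G) :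
    ∃ w : List S, ConjClasses.mk (wordEval w) = c ∧ wordWeight ω w = classWeight ω c := by
  have hne : (elementWeight ω '' c.carrier).Nonempty := by
    obtain ⟨g, rfl⟩ := ConjClasses.exists_rep c
    exact ⟨_, g, ConjClasses.mem_carrier_mk, rfl⟩
  obtain ⟨g, hg, hgw⟩ := Nat.sInf_mem hne
  obtain ⟨v, hv⟩ := exists_wordEval_eq hS g
  obtain ⟨w, hw, hww⟩ := Nat.sInf_mem
    (s := {n : ℕ | ∃ w : List S, wordEval w = g ∧ wordWeight ω w = n}) ⟨_, v, hv, rfl⟩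
  refine ⟨w, ?_, hww.trans hgw⟩
  rw [hw]
  exact ConjClasses.mem_carrier_iff_mk_eq.1 hg

theorem length_le_wordWeight {G : Type*} {S : Finset G} (ω : S → ℕ) (hω : ∀ s, 0 < ω s)
    (w : List S) : w.length ≤ wordWeight ω w := by
  induction w with
  | nil => simp
  | cons a l ih =>
    have h := hω a
    simp only [wordWeight, List.map_cons, List.sum_cons, List.length_cons] at ih ⊢
    omega

/-- The sets counted by `conjGrowth` are finite, so that `Set.ncard` is their true size. -/
theorem finite_classWeight_eq {G : Type*} [Group G] {S : Finset G}
    (hS : Submonoid.closure (S : Set G) = ⊤) (ω : S → ℕ) (hω : ∀ s, 0 < ω s) (n : ℕ) :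
    {c : ConjClasses G | classWeight ω c = n}.Finite := by
  refine ((List.finite_length_le S n).image
    (fun w => ConjClasses.mk (wordEval w))).subset ?_
  intro c hc
  obtain ⟨w, hw, hww⟩ := exists_word_classWeight hS ω c
  refine ⟨w, ?_, hw⟩
  have h := length_le_wordWeight ω hω w
  have hc' : classWeight ω c = n := hc
  show w.length ≤ n
  omega

end WeightedGrowth

/-! ### Rational series and weighted counting -/

namespace WeightedGrowth

open PowerSeries

/-! Passing to the normal core, let `A` be abelian, normal and of finite index. A word over `S` is a
path in the finite Cayley graph of `G ⧸ A`; once coset representatives are chosen, edges carry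
labels in the commutative monoid `A × ℕ`, the `A`-part and the weight. By Kleene's theorem the pairs
(element, word weight) in one coset form a semilinear set (`isSemilinearSet_wordEval_coset`).
Conjugation by `b * g`, with `b ∈ A` and `g` fixed, becomes a linear equation modulo a subgroup of
`A`, so conjugacy is semilinear too (`isSemilinearSet_setOf_conj`).

After pulling back to `ℕ^k`, where semilinear sets are closed under differences, one point of least
weight per class can be selected semilinearly (`exists_isSemilinearSet_transversal`). The growth
series then counts a semilinear set by a linear weight, and such series are rational
(`isRationalSeries_countSeries_of_isSemilinearSet`): the set is a finite union of injective affine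
images of parallelogram-closed subsets of `ℕ^r`. These images are closed under intersection, so
inclusion-exclusion leaves a single parallelogram-closed set, treated by induction on the number of
free coordinates. -/

theorem isRationalSeries_coe (p : Polynomial ℤ) : IsRationalSeries (p : PowerSeries ℤ) :=
  ⟨p, 1, one_ne_zero, by simp⟩

theorem IsRationalSeries.add {f g : PowerSeries ℤ} (hf : IsRationalSeries f)
    (hg : IsRationalSeries g) : IsRationalSeries (f + g) := by
  obtain ⟨p, q, hq, h⟩ := hf
  obtain ⟨p', q', hq', h'⟩ := hg
  refine ⟨p * q' + p' * q, q * q', mul_ne_zero hq hq', ?_⟩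
  simp only [Polynomial.coe_mul, Polynomial.coe_add, ← h, ← h']
  ring

theorem IsRationalSeries.mul {f g : PowerSeries ℤ} (hf : IsRationalSeries f)
    (hg : IsRationalSeries g) : IsRationalSeries (f * g) := by
  obtain ⟨p, q, hq, h⟩ := hf
  obtain ⟨p', q', hq', h'⟩ := hg
  refine ⟨p * p', q * q', mul_ne_zero hq hq', ?_⟩
  simp only [Polynomial.coe_mul, ← h, ← h']
  ring

theorem IsRationalSeries.neg {f : PowerSeries ℤ} (hf : IsRationalSeries f) :
    IsRationalSeries (-f) := by
  obtain ⟨p, q, hq, h⟩ := hf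
  exact ⟨-p, q, hq, by rw [mul_neg, h, Polynomial.coe_neg]⟩

theorem IsRationalSeries.sub {f g : PowerSeries ℤ} (hf : IsRationalSeries f)
    (hg : IsRationalSeries g) : IsRationalSeries (f - g) := by
  rw [sub_eq_add_neg]
  exact hf.add hg.neg

theorem IsRationalSeries.of_mul_coe {f : PowerSeries ℤ} {p : Polynomial ℤ} (hp : p ≠ 0)
    (hf : IsRationalSeries ((p : PowerSeries ℤ) * f)) : IsRationalSeries f := by
  obtain ⟨p', q, hq, h⟩ := hf
  exact ⟨p', q * p, mul_ne_zero hq hp, by rw [Polynomial.coe_mul, mul_assoc, h]⟩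

variable {α β : Type*}

/-- A set has finite fibres for a weight if it has finitely many elements of each weight. -/
def HasFiniteFibers (w : α → ℕ) (s : Set α) : Prop :=
  ∀ n, {x | x ∈ s ∧ w x = n}.Finite

/-- The generating function counting the elements of a set by weight. -/
noncomputable def countSeries (w : α → ℕ) (s : Set α) : PowerSeries ℤ :=
  PowerSeries.mk fun n => ({x | x ∈ s ∧ w x = n}.ncard : ℤ)

theorem HasFiniteFibers.mono {w : α → ℕ} {s t : Set α} (h : HasFiniteFibers w t) (hst : s ⊆ t) :
    HasFiniteFibers w s :=
  fun n => (h n).subset fun _ hx => ⟨hst hx.1, hx.2⟩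

theorem HasFiniteFibers.of_image {w : β → ℕ} {g : α → β} {s : Set α} (hg : Set.InjOn g s)
    (h : HasFiniteFibers w (g '' s)) : HasFiniteFibers (w ∘ g) s := by
  intro n
  refine Set.Finite.of_finite_image (f := g) ((h n).subset ?_) (hg.mono fun x hx => hx.1)
  rintro _ ⟨x, hx, rfl⟩
  exact ⟨⟨x, hx.1, rfl⟩, hx.2⟩

theorem HasFiniteFibers.of_const_add {w : α → ℕ} {s : Set α} (c : ℕ)
    (h : HasFiniteFibers (fun x => c + w x) s) : HasFiniteFibers w s := by
  intro n
  refine (h (c + n)).subset fun x hx => ⟨hx.1, ?_⟩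
  simp [hx.2]

theorem countSeries_union_add_inter {w : α → ℕ} {s t : Set α} (h : HasFiniteFibers w (s ∪ t)) :
    countSeries w (s ∪ t) + countSeries w (s ∩ t) = countSeries w s + countSeries w t := by
  ext n
  simp only [countSeries, map_add, coeff_mk]
  have := Set.ncard_union_add_ncard_inter {x | x ∈ s ∧ w x = n} {x | x ∈ t ∧ w x = n}
    (h.mono Set.subset_union_left n) (h.mono Set.subset_union_right n)
  rw [← Nat.cast_add, ← Nat.cast_add, ← this]
  congr! 3
  · ext x
    simp [or_and_right]
  · ext x
    simp only [Set.mem_inter_iff, Set.mem_ofPred_eq]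
    tauto

@[simp]
theorem countSeries_empty (w : α → ℕ) : countSeries w ∅ = 0 := by
  ext n
  simp [countSeries]

theorem countSeries_singleton (w : α → ℕ) (a : α) : countSeries w {a} = X ^ w a := by
  ext n
  simp only [countSeries, coeff_mk, coeff_X_pow]
  by_cases h : n = w a
  · have : {x | x ∈ ({a} : Set α) ∧ w x = n} = {a} := by
      ext x
      simp only [Set.mem_singleton_iff, Set.mem_ofPred_eq]
      exact ⟨fun hx => hx.1, fun hx => ⟨hx, by rw [hx, h]⟩⟩
    rw [this]
    simp [h]
  · have : {x | x ∈ ({a} : Set α) ∧ w x = n} = ∅ := by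
      ext x
      simp only [Set.mem_singleton_iff, Set.mem_ofPred_eq, Set.mem_empty_iff_false, iff_false]
      rintro ⟨rfl, hx⟩
      exact h hx.symm
    rw [this]
    simp [h]

theorem countSeries_image {w : β → ℕ} {g : α → β} {s : Set α} (hg : Set.InjOn g s) :
    countSeries w (g '' s) = countSeries (w ∘ g) s := by
  ext n
  simp only [countSeries, coeff_mk]
  have : {y | y ∈ g '' s ∧ w y = n} = g '' {x | x ∈ s ∧ (w ∘ g) x = n} := by
    ext y
    constructor
    · rintro ⟨⟨x, hx, rfl⟩, h⟩
      exact ⟨x, ⟨hx, h⟩, rfl⟩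
    · rintro ⟨x, hx, rfl⟩
      exact ⟨⟨x, hx.1, rfl⟩, hx.2⟩
  rw [this, (hg.mono fun x hx => hx.1).ncard_image]

theorem countSeries_const_add (w : α → ℕ) (s : Set α) (c : ℕ) :
    countSeries (fun x => c + w x) s = X ^ c * countSeries w s := by
  ext n
  rw [coeff_X_pow_mul']
  simp only [countSeries, coeff_mk]
  split_ifs with h
  · have : {x | x ∈ s ∧ c + w x = n} = {x | x ∈ s ∧ w x = n - c} := by
      ext x
      exact and_congr_right fun _ => by omega
    rw [this]
  · have : {x | x ∈ s ∧ c + w x = n} = ∅ := by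
      ext x
      simp only [Set.mem_ofPred_eq, Set.mem_empty_iff_false, iff_false]
      rintro ⟨-, hx⟩
      omega
    simp [this]

/-- Inclusion and exclusion: a finite union of members of an intersection-closed family of sets
with rational generating functions has a rational generating function. -/
theorem isRationalSeries_countSeries_biUnion {ι : Type*} {w : α → ℕ} {P : Set α → Prop}
    (hinter : ∀ s t, P s → P t → P (s ∩ t))
    (hP : ∀ s, P s → HasFiniteFibers w s → IsRationalSeries (countSeries w s))
    (F : Finset ι) (f : ι → Set α) (hf : ∀ i ∈ F, P (f i))
    (hfin : HasFiniteFibers w (⋃ i ∈ F, f i)) :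
    IsRationalSeries (countSeries w (⋃ i ∈ F, f i)) := by
  classical
  induction F using Finset.induction_on generalizing f with
  | empty => simpa using isRationalSeries_coe 0
  | insert i F _ ih =>
    rw [Finset.set_biUnion_insert] at hfin ⊢
    have key := countSeries_union_add_inter hfin
    rw [← eq_sub_iff_add_eq] at key
    rw [key]
    have hi := hf i (Finset.mem_insert_self _ _)
    have hF : ∀ j ∈ F, P (f j) := fun j hj => hf j (Finset.mem_insert_of_mem hj)
    have h1 := hP _ hi (hfin.mono Set.subset_union_left)
    have h2 := ih f hF (hfin.mono Set.subset_union_right)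
    refine (h1.add h2).sub ?_
    -- The correction term is again a union over `F` of members of the family, so the induction
    -- hypothesis, valid for every `f`, applies to it.
    have e : f i ∩ ⋃ j ∈ F, f j = ⋃ j ∈ F, f i ∩ f j := by
      simp only [Set.inter_iUnion]
    rw [e]
    refine ih (fun j => f i ∩ f j) (fun j hj => hinter _ _ hi (hF j hj)) ?_
    rw [← e]
    exact hfin.mono (Set.inter_subset_left.trans Set.subset_union_left)

end WeightedGrowth

/-! ### Rational generating functions of semilinear sets -/

namespace WeightedGrowth

open PowerSeries Pointwise

/-- A set `s` such that `x + y - z ∈ s` whenever `x, y, z ∈ s` and the difference exists.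
Solution sets of linear equations have this property. -/
def IsParallelogramClosed {M : Type*} [Add M] (s : Set M) : Prop :=
  ∀ ⦃x y z v : M⦄, x ∈ s → y ∈ s → z ∈ s → x + y = z + v → v ∈ s

theorem IsParallelogramClosed.inter {M : Type*} [Add M] {s t : Set M}
    (hs : IsParallelogramClosed s) (ht : IsParallelogramClosed t) :
    IsParallelogramClosed (s ∩ t) :=
  fun _ _ _ _ hx hy hz h => ⟨hs hx.1 hy.1 hz.1 h, ht hx.2 hy.2 hz.2 h⟩

theorem isParallelogramClosed_apply_eq {ι : Type*} (i : ι) (j : ℕ) :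
    IsParallelogramClosed {y : ι → ℕ | y i = j} := by
  intro x y z v hx hy hz h
  have := congrFun h i
  simp only [Pi.add_apply, Set.mem_ofPred_eq] at *
  omega

theorem IsParallelogramClosed.preimage {M N : Type*} [AddZeroClass M] [AddZeroClass N] {s : Set N}
    (hs : IsParallelogramClosed s) (f : M →+ N) : IsParallelogramClosed (f ⁻¹' s) := by
  intro x y z v hx hy hz h
  exact hs hx hy hz (by rw [← map_add, h, map_add])

theorem isParallelogramClosed_setOf_eq {M N : Type*} [AddZeroClass M] [AddCancelCommMonoid N]
    (a b : N) (f g : M →+ N) : IsParallelogramClosed {x | a + f x = b + g x} := by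
  intro x y z v hx hy hz h
  simp only [Set.mem_ofPred_eq] at *
  have hf := congrArg f h
  have hg := congrArg g h
  rw [map_add, map_add] at hf hg
  refine add_left_cancel (a := a + f z) ?_
  calc a + f z + (a + f v) = a + a + (f z + f v) := by abel
    _ = (a + f x) + (a + f y) := by rw [← hf]; abel
    _ = (b + b) + (g x + g y) := by rw [hx, hy]; abel
    _ = (b + g z) + (b + g v) := by rw [hg]; abel
    _ = a + f z + (b + g v) := by rw [hz]

section Slices

variable {ι : Type*}

theorem add_image_eq {s : Set (ι → ℕ)} {x : ι → ℕ} :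
    (fun y => x + y) '' {y | x + y ∈ s} = {y ∈ s | x ≤ y} := by
  ext y
  constructor
  · rintro ⟨z, hz, rfl⟩
    exact ⟨hz, le_self_add⟩
  · rintro ⟨hy, hxy⟩
    obtain ⟨z, rfl⟩ := exists_add_of_le hxy
    exact ⟨z, hy, rfl⟩

theorem countSeries_eq_translate_add {s : Set (ι → ℕ)} {w : (ι → ℕ) →+ ℕ}
    (hfin : HasFiniteFibers w s) (x : ι → ℕ) :
    countSeries w s = X ^ w x * countSeries w {y | x + y ∈ s} + countSeries w {y ∈ s | ¬ x ≤ y} := by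
  have e : s = {y ∈ s | x ≤ y} ∪ {y ∈ s | ¬ x ≤ y} := by
    ext y
    by_cases h : x ≤ y <;> simp [h]
  have e' : {y ∈ s | x ≤ y} ∩ {y ∈ s | ¬ x ≤ y} = ∅ := by
    ext y
    by_cases h : x ≤ y <;> simp [h]
  have key := countSeries_union_add_inter (w := w) (s := {y ∈ s | x ≤ y})
    (t := {y ∈ s | ¬ x ≤ y}) (by rwa [← e])
  rw [← e, e', countSeries_empty, add_zero, ← add_image_eq,
    countSeries_image (add_right_injective x).injOn] at key
  rw [key, ← countSeries_const_add]
  congr 2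
  ext y
  simp

theorem HasFiniteFibers.translate {s : Set (ι → ℕ)} {w : (ι → ℕ) →+ ℕ}
    (hfin : HasFiniteFibers w s) (x : ι → ℕ) : HasFiniteFibers w {y | x + y ∈ s} := by
  have h := HasFiniteFibers.of_image (w := w) (add_right_injective x).injOn
    ((hfin.mono (t := s) (s := {y ∈ s | x ≤ y}) fun _ h => h.1).mono add_image_eq.subset)
  refine HasFiniteFibers.of_const_add (w x) ?_
  convert h using 2 with y
  simp

/-- A point not above `x` lies in one of the finitely many slices `y i = j` with `j < x i`. Here `i
∈ t`, since the coordinates outside `t` are frozen at `a i ≥ x i`. Each slice has one free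
coordinate fewer, so `ih` applies to it. -/
theorem IsParallelogramClosed.isRationalSeries_countSeries_not_le [DecidableEq ι]
    {t : Finset ι} {a : ι → ℕ}
    {w : (ι → ℕ) →+ ℕ}
    (ih : ∀ i ∈ t, ∀ (b : ι → ℕ) (s' : Set (ι → ℕ)), IsParallelogramClosed s' →
      (∀ x ∈ s', ∀ k, k ∉ t.erase i → x k = b k) → HasFiniteFibers w s' →
      IsRationalSeries (countSeries w s'))
    {s : Set (ι → ℕ)} (hs : IsParallelogramClosed s) (ht : ∀ x ∈ s, ∀ i, i ∉ t → x i = a i)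
    (hfin : HasFiniteFibers w s) {x : ι → ℕ} (hx : ∀ i, i ∉ t → x i ≤ a i) :
    IsRationalSeries (countSeries w {y ∈ s | ¬ x ≤ y}) := by
  have e : {y ∈ s | ¬ x ≤ y} = ⋃ p ∈ t.sigma fun i => Finset.range (x i),
      s ∩ {y : ι → ℕ | y p.1 = p.2} := by
    ext y
    simp only [Pi.le_def, Set.mem_iUnion, Finset.mem_sigma, Finset.mem_range]
    constructor
    · rintro ⟨hy, hxy⟩
      push Not at hxy
      obtain ⟨i, hi⟩ := hxy
      refine ⟨⟨i, y i⟩, ⟨?_, hi⟩, hy, rfl⟩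
      by_contra hit
      have := ht y hy i hit
      have := hx i hit
      omega
    · rintro ⟨⟨i, j⟩, ⟨hit, hj⟩, hy, hyj⟩
      refine ⟨hy, fun h => ?_⟩
      have := h i
      simp only [Set.mem_ofPred_eq] at hj hyj
      omega
  have hfin' : HasFiniteFibers w {y ∈ s | ¬ x ≤ y} := hfin.mono fun _ h => h.1
  rw [e] at hfin' ⊢
  refine isRationalSeries_countSeries_biUnion
    (P := fun s' => IsParallelogramClosed s' ∧ s' ⊆ s ∧ ∃ i ∈ t, ∃ j, ∀ y ∈ s', y i = j)
    ?_ ?_ _ _ ?_ hfin'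
  · rintro s₁ s₂ ⟨h1, h2, i, hi, j, hj⟩ ⟨h1', -⟩
    exact ⟨h1.inter h1', Set.inter_subset_left.trans h2, i, hi, j, fun y hy => hj y hy.1⟩
  · rintro s' ⟨h1, h2, i, hi, j, hj⟩ hf
    refine ih i hi (Function.update a i j) s' h1 (fun y hy k hk => ?_) hf
    by_cases hki : k = i
    · subst hki
      simp [hj y hy]
    · rw [Function.update_of_ne hki]
      exact ht y (h2 hy) k fun hkt => hk (Finset.mem_erase.2 ⟨hki, hkt⟩)
  · rintro ⟨i, j⟩ hp
    rw [Finset.mem_sigma] at hp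
    exact ⟨hs.inter (isParallelogramClosed_apply_eq i j), Set.inter_subset_left, i, hp.1, j,
      fun y hy => hy.2⟩

/-- The generating function of the solution set of a linear system over `ℕ` is rational. -/
theorem IsParallelogramClosed.isRationalSeries_countSeries [Finite ι] {s : Set (ι → ℕ)}
    (hs : IsParallelogramClosed s) (w : (ι → ℕ) →+ ℕ) (hfin : HasFiniteFibers w s) :
    IsRationalSeries (countSeries w s) := by
  classical
  -- `t` is the set of free coordinates; the others are frozen at the values of `a`.
  suffices h : ∀ (t : Finset ι) (a : ι → ℕ) (s : Set (ι → ℕ)), IsParallelogramClosed s →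
      (∀ x ∈ s, ∀ i, i ∉ t → x i = a i) → HasFiniteFibers w s →
      IsRationalSeries (countSeries w s) by
    have := Fintype.ofFinite ι
    exact h Finset.univ 0 s hs (by simp) hfin
  intro t
  induction t using Finset.strongInductionOn with | _ t ih
  replace ih := fun i (hi : i ∈ t) => ih (t.erase i) (Finset.erase_ssubset hi)
  intro a s hs ht hfin
  obtain rfl | ⟨x, hx⟩ := s.eq_empty_or_nonempty
  · simpa using isRationalSeries_coe 0
  have hxa := ht x hx
  rw [countSeries_eq_translate_add hfin x]
  refine .add (.mul ?_ ?_)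
    (hs.isRationalSeries_countSeries_not_le ih ht hfin fun i hi => (hxa i hi).le)
  · simpa using isRationalSeries_coe (Polynomial.X ^ w x)
  have hK := hfin.translate x
  -- `K` is `s - x` inside `ℕ^ι`: a submonoid also closed under those differences that exist.
  set K := {y | x + y ∈ s} with hKdef
  have h0 : (0 : ι → ℕ) ∈ K := by simpa [hKdef] using hx
  have hadd : ∀ {y z}, y ∈ K → z ∈ K → y + z ∈ K := fun {y z} hy hz =>
    hs hy hz hx (show x + y + (x + z) = x + (x + (y + z)) by abel)
  have hsub : ∀ {y z}, y ∈ K → y + z ∈ K → z ∈ K := fun {y z} hy hz =>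
    hs hz hx hy (show x + (y + z) + x = x + y + (x + z) by abel)
  by_cases hne : ∃ u ∈ K, u ≠ 0
  · obtain ⟨u, hu, hu0⟩ := hne
    -- If `w u = 0`, all multiples of `u` would lie in the finite fibre of weight `0`.
    have hwu : w u ≠ 0 := by
      intro hw
      have hmem : ∀ n : ℕ, n • u ∈ K := by
        intro n
        induction n with
        | zero => simpa using h0
        | succ n ih => rw [succ_nsmul]; exact hadd ih hu
      have hinj : Function.Injective fun n : ℕ => n • u := by
        obtain ⟨i, hi⟩ := Function.ne_iff.1 hu0
        intro n m hnm
        have := congrFun hnm i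
        simp only [Pi.smul_apply, smul_eq_mul] at this
        exact Nat.eq_of_mul_eq_mul_right (Nat.pos_of_ne_zero hi) this
      have hmem0 : ∀ n : ℕ, n • u ∈ {x | x ∈ K ∧ w x = 0} := fun n =>
        ⟨hmem n, by rw [map_nsmul, hw, smul_zero]⟩
      exact Set.infinite_of_injective_forall_mem hinj hmem0 (hK 0)
    have key := countSeries_eq_translate_add hK u
    -- Translation by `u` maps `K` onto its part above `u`, so multiplying by `1 - X ^ w u` leaves
    -- only the points not above `u`.
    have e : {y | u + y ∈ K} = K := Set.ext fun y => ⟨hsub hu, hadd hu⟩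
    rw [e] at key
    refine IsRationalSeries.of_mul_coe (p := 1 - Polynomial.X ^ w u) ?_ ?_
    · intro h
      have := congrArg (Polynomial.coeff · 0) h
      simp [Polynomial.coeff_X_pow, hwu.symm] at this
    · have e2 : ((1 - Polynomial.X ^ w u : Polynomial ℤ) : PowerSeries ℤ) * countSeries w K =
          countSeries w {y ∈ K | ¬ u ≤ y} := by
        rw [Polynomial.coe_sub, Polynomial.coe_pow, Polynomial.coe_X, Polynomial.coe_one, sub_mul,
          one_mul, sub_eq_iff_eq_add]
        rw [add_comm]
        exact key
      rw [e2]
      have hKt : ∀ y ∈ K, ∀ i, i ∉ t → y i = (0 : ι → ℕ) i := by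
        intro y hy i hi
        have h1 := ht _ hy i hi
        have h2 := hxa i hi
        simp only [Pi.add_apply, Pi.zero_apply] at *
        omega
      refine IsParallelogramClosed.isRationalSeries_countSeries_not_le ih ?_ hKt hK
        fun i hi => (hKt u hu i hi).le
      intro y z v v' hy hz hv h
      exact hsub hv (h ▸ hadd hy hz)
  · push Not at hne
    have : K = {0} := Set.eq_singleton_iff_unique_mem.2 ⟨h0, hne⟩
    rw [this, countSeries_singleton]
    simpa using isRationalSeries_coe 1

end Slices

/-- Injective affine images of parallelogram-closed sets of tuples of natural numbers. -/
def IsUnambiguous {M : Type*} [AddCommMonoid M] (X : Set M) : Prop :=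
  ∃ (r : ℕ) (s : Set (Fin r → ℕ)) (a : M) (φ : (Fin r → ℕ) →+ M),
    IsParallelogramClosed s ∧ Set.InjOn (fun x => a + φ x) s ∧ X = (fun x => a + φ x) '' s

theorem isUnambiguous_of_finite {M ι : Type*} [AddCommMonoid M] [Finite ι] {s : Set (ι → ℕ)}
    {a : M} {φ : (ι → ℕ) →+ M} (hs : IsParallelogramClosed s)
    (hφ : Set.InjOn (fun x => a + φ x) s) : IsUnambiguous ((fun x => a + φ x) '' s) := by
  obtain ⟨r, ⟨e⟩⟩ := Finite.exists_equiv_fin ι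
  let E : (Fin r → ℕ) ≃+ (ι → ℕ) :=
    { toFun := fun x => x ∘ e
      invFun := fun x => x ∘ e.symm
      left_inv := fun x => by ext; simp
      right_inv := fun x => by ext; simp
      map_add' := fun x y => rfl }
  refine ⟨r, E ⁻¹' s, a, φ.comp E.toAddMonoidHom, hs.preimage E.toAddMonoidHom, ?_, ?_⟩
  · intro x hx y hy h
    exact E.injective (hφ hx hy h)
  · ext m
    constructor
    · rintro ⟨x, hx, rfl⟩
      exact ⟨E.symm x, by simpa using hx, by simp⟩
    · rintro ⟨x, hx, rfl⟩
      exact ⟨E x, hx, rfl⟩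

/-- The intersection is parametrized by the fibre product of the two parameter sets, cut out by a
linear equation; each factor is determined by the image point. Proper linear sets lack this closure
property, hence the larger family. -/
theorem IsUnambiguous.inter {M : Type*} [AddCancelCommMonoid M] {X Y : Set M}
    (hX : IsUnambiguous X) (hY : IsUnambiguous Y) : IsUnambiguous (X ∩ Y) := by
  obtain ⟨r, s, a, φ, hs, hφ, rfl⟩ := hX
  obtain ⟨r', s', a', φ', hs', hφ', rfl⟩ := hY
  let p₁ : (Fin r ⊕ Fin r' → ℕ) →+ (Fin r → ℕ) :=
    { toFun := fun x => x ∘ Sum.inl, map_zero' := rfl, map_add' := fun _ _ => rfl }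
  let p₂ : (Fin r ⊕ Fin r' → ℕ) →+ (Fin r' → ℕ) :=
    { toFun := fun x => x ∘ Sum.inr, map_zero' := rfl, map_add' := fun _ _ => rfl }
  let s'' := p₁ ⁻¹' s ∩ (p₂ ⁻¹' s' ∩ {x | a + φ.comp p₁ x = a' + φ'.comp p₂ x})
  have hs'' : IsParallelogramClosed s'' :=
    (hs.preimage p₁).inter ((hs'.preimage p₂).inter (isParallelogramClosed_setOf_eq _ _ _ _))
  have e : (fun x => a + φ x) '' s ∩ (fun x => a' + φ' x) '' s' =
      (fun x => a + φ.comp p₁ x) '' s'' := by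
    ext m
    constructor
    · rintro ⟨⟨x, hx, rfl⟩, ⟨y, hy, h⟩⟩
      exact ⟨Sum.elim x y, ⟨hx, hy, h.symm⟩, rfl⟩
    · rintro ⟨z, ⟨hz1, hz2, hz3⟩, rfl⟩
      exact ⟨⟨p₁ z, hz1, rfl⟩, ⟨p₂ z, hz2, hz3.symm⟩⟩
  rw [e]
  refine isUnambiguous_of_finite hs'' ?_
  rintro x ⟨hx1, hx2, hx3⟩ y ⟨hy1, hy2, hy3⟩ h
  have h1 : p₁ x = p₁ y := hφ hx1 hy1 h
  have h2 : p₂ x = p₂ y := hφ' hx2 hy2 (hx3.symm.trans (Eq.trans h hy3))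
  ext (i | i)
  · exact congrFun h1 i
  · exact congrFun h2 i

theorem IsProperLinearSet.isUnambiguous {M : Type*} [AddCancelCommMonoid M] {X : Set M}
    (hX : IsProperLinearSet X) : IsUnambiguous X := by
  rw [isProperLinearSet_iff] at hX
  obtain ⟨a, t, ht, rfl⟩ := hX
  have hφ : Function.Injective (Fintype.linearCombination ℕ (Subtype.val : t → M)) :=
    LinearIndependent.fintypeLinearCombination_injective ht
  have e : a +ᵥ (AddSubmonoid.closure (t : Set M) : Set M) = (fun x => a +
      (Fintype.linearCombination ℕ (Subtype.val : t → M)).toAddMonoidHom x) '' Set.univ := by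
    have h := Fintype.range_linearCombination ℕ (Subtype.val : t → M)
    have h' : (Submodule.span ℕ (t : Set M) : Set M) = AddSubmonoid.closure (t : Set M) := by
      rw [← Submodule.coe_toAddSubmonoid, Submodule.span_nat_eq_addSubmonoidClosure]
    rw [← h']
    ext m
    simp only [Subtype.range_coe_subtype, Finset.setOfPred_mem] at h
    rw [Set.mem_vadd_set, ← h]
    simp only [SetLike.mem_coe, LinearMap.mem_range, vadd_eq_add, exists_exists_eq_and]
    simp
  rw [e]
  exact isUnambiguous_of_finite (fun _ _ _ _ _ _ _ _ => trivial)
    fun x _ y _ h => hφ (add_left_cancel h)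

theorem IsUnambiguous.isRationalSeries_countSeries {M : Type*} [AddCommMonoid M]
    {X : Set M} (hX : IsUnambiguous X) (w : M →+ ℕ) (hfin : HasFiniteFibers w X) :
    IsRationalSeries (countSeries w X) := by
  obtain ⟨r, s, a, φ, hs, hφ, rfl⟩ := hX
  have e : (w ∘ fun x => a + φ x) = fun x => w a + w.comp φ x := by
    ext x
    simp
  have hfin' := hfin.of_image hφ
  rw [e] at hfin'
  rw [countSeries_image hφ, e, countSeries_const_add]
  refine .mul ?_ (hs.isRationalSeries_countSeries _ hfin'.of_const_add)
  simpa using isRationalSeries_coe (Polynomial.X ^ w a)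

/-- A semilinear set has a rational generating function with respect to every linear weight for
which it has finite fibres. -/
theorem isRationalSeries_countSeries_of_isSemilinearSet {M : Type*} [AddCancelCommMonoid M]
    {X : Set M} (hX : IsSemilinearSet X) (w : M →+ ℕ) (hfin : HasFiniteFibers w X) :
    IsRationalSeries (countSeries w X) := by
  have h := hX.isProperSemilinearSet
  rw [isProperSemilinearSet_iff] at h
  obtain ⟨F, hF, rfl⟩ := h
  have e : ⋃₀ (F : Set (Set M)) = ⋃ i ∈ F, id i := by
    simp [Set.sUnion_eq_biUnion]
  rw [e] at hfin ⊢
  exact isRationalSeries_countSeries_biUnion (P := IsUnambiguous) (fun _ _ h h' => h.inter h')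
    (fun s hs hf => hs.isRationalSeries_countSeries w hf) F id
    (fun i hi => IsProperLinearSet.isUnambiguous (hF i hi)) hfin

end WeightedGrowth

/-! ### Kleene's theorem in commutative monoids -/

namespace WeightedGrowth

open Pointwise

section Kleene

variable {M Q : Type*} [AddCommMonoid M]

/-- The labels of nonempty paths in a labelled graph with all interior vertices in `K`. -/
inductive PathLabel (d : Q → Q → Set M) (K : Finset Q) (p : Q) : Q → M → Prop
  | single {q : Q} {e : M} (he : e ∈ d p q) : PathLabel d K p q e
  | step {q r : Q} {m e : M} (hm : PathLabel d K p q m) (hq : q ∈ K) (he : e ∈ d q r) :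
      PathLabel d K p r (m + e)

variable {d : Q → Q → Set M} {K : Finset Q}

theorem PathLabel.mono {K' : Finset Q} (hK : K ⊆ K') {p q : Q} {m : M}
    (h : PathLabel d K p q m) : PathLabel d K' p q m := by
  induction h with
  | single he => exact .single he
  | step _ hq he ih => exact .step ih (hK hq) he

theorem PathLabel.append {p k q : Q} {m m' : M} (h : PathLabel d K p k m) (hk : k ∈ K)
    (h' : PathLabel d K k q m') : PathLabel d K p q (m + m') := by
  induction h' with
  | single he => exact .step h hk he
  | step _ hq he ih => rw [← add_assoc]; exact .step ih hq he

theorem setOf_pathLabel_empty (p q : Q) : {m | PathLabel d ∅ p q m} = d p q := by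
  ext m
  constructor
  · rintro (he | ⟨-, hq, -⟩)
    · exact he
    · simp at hq
  · exact .single

/-- A path that visits `k` is cut at its visits: an initial piece, loops at `k`, and a final piece,
all with interior in `K`. -/
theorem setOf_pathLabel_insert [DecidableEq Q] (k p q : Q) :
    {m | PathLabel d (insert k K) p q m} = {m | PathLabel d K p q m} ∪
      ({m | PathLabel d K p k m} + ((AddSubmonoid.closure {m | PathLabel d K k k m} : Set M) +
        {m | PathLabel d K k q m})) := by
  have hsub : K ⊆ insert k K := Finset.subset_insert k K
  ext m
  constructor
  · intro h
    change PathLabel d (insert k K) p q m at h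
    induction h with
    | single he => exact .inl (.single he)
    | @step q r m e _ hq he ih =>
      by_cases hqk : q = k
      · subst hqk
        right
        -- The path so far ends at `k`: its last piece `b` is a loop and joins `z`, and the new edge
        -- starts the final piece.
        obtain h | ⟨a, ha, _, ⟨z, hz, b, hb, rfl⟩, rfl⟩ := ih
        · exact ⟨m, h, e, ⟨0, zero_mem _, e, .single he, zero_add e⟩, rfl⟩
        · exact ⟨a, ha, z + b + e, ⟨z + b, add_mem hz (AddSubmonoid.subset_closure hb), e,
            .single he, rfl⟩, (add_assoc _ _ _).symm⟩
      · have hqK : q ∈ K := Finset.mem_of_mem_insert_of_ne hq hqk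
        obtain h | ⟨a, ha, _, ⟨z, hz, b, hb, rfl⟩, rfl⟩ := ih
        · exact .inl (PathLabel.step h hqK he)
        · right
          refine ⟨a, ha, z + (b + e), ⟨z, hz, b + e, PathLabel.step hb hqK he, rfl⟩, ?_⟩
          simp only [add_assoc]
  · rintro (h | ⟨a, ha, _, ⟨z, hz, b, hb, rfl⟩, rfl⟩)
    · exact h.mono hsub
    · have hk : k ∈ insert k K := Finset.mem_insert_self k K
      suffices h : ∀ z ∈ AddSubmonoid.closure {m | PathLabel d K k k m}, ∀ b,
          PathLabel d (insert k K) k q b → PathLabel d (insert k K) k q (z + b) from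
        (ha.mono hsub).append hk (h z hz b (hb.mono hsub))
      intro z hz
      induction hz using AddSubmonoid.closure_induction with
      | mem x hx => exact fun b hb => (PathLabel.mono hsub hx).append hk hb
      | zero => simp
      | add x y _ _ hx hy => intro b hb; rw [add_assoc]; exact hx _ (hy _ hb)

/-- Kleene's theorem for finite graphs labelled in a commutative monoid. -/
theorem isSemilinearSet_pathLabel (hd : ∀ p q, IsSemilinearSet (d p q)) (K : Finset Q) (p q : Q) :
    IsSemilinearSet {m | PathLabel d K p q m} := by
  classical
  induction K using Finset.induction_on generalizing p q with
  | empty => rw [setOf_pathLabel_empty]; exact hd p q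
  | insert k K _ ih =>
    rw [setOf_pathLabel_insert]
    exact (ih p q).union ((ih p k).add ((ih k k).closure.add (ih k q)))

end Kleene

/-! ### Semilinear choice of minimal representatives -/

section Transversal

/-- A slack variable `n` with `1 + f x + n = g x` turns the inequality into a linear equation, and
projection forgets it. -/
theorem isSemilinearSet_setOf_lt {M : Type*} [AddCommMonoid M] [AddMonoid.FG M] (f g : M →+ ℕ) :
    IsSemilinearSet {x | f x < g x} := by
  have h : IsSemilinearSet {z : M × ℕ | 1 + (f.coprod (AddMonoidHom.id ℕ)) z =
      0 + (g.comp (AddMonoidHom.fst M ℕ)) z} := isSemilinearSet_setOfPred_eq _ _ _ _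
  convert h.image (AddMonoidHom.fst M ℕ)
  ext x
  simp only [Set.mem_ofPred_eq, Set.mem_image, Prod.exists]
  constructor
  · intro hx
    exact ⟨x, g x - f x - 1, by simp; omega, rfl⟩
  · rintro ⟨y, n, hn, rfl⟩
    simp at hn ⊢
    omega

theorem isSemilinearSet_setOf_toLex_lt {M : Type*} [AddCommMonoid M] [AddMonoid.FG M] {k : ℕ}
    (f g : M →+ (Fin k → ℕ)) : IsSemilinearSet {x | toLex (f x) < toLex (g x)} := by
  have e : {x | toLex (f x) < toLex (g x)} = ⋃ i, ((⋂ j ∈ Finset.univ.filter (· < i),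
      {x | 0 + (Pi.evalAddMonoidHom (fun _ => ℕ) j).comp f x =
        0 + (Pi.evalAddMonoidHom (fun _ => ℕ) j).comp g x}) ∩
      {x | (Pi.evalAddMonoidHom (fun _ => ℕ) i).comp f x <
        (Pi.evalAddMonoidHom (fun _ => ℕ) i).comp g x}) := by
    ext x
    simp only [Finset.mem_filter_univ, zero_add, AddMonoidHom.comp_apply, Pi.evalAddMonoidHom_apply,
      Set.mem_iUnion, Set.mem_inter_iff, Set.mem_iInter, Set.mem_ofPred_eq]
    rfl
  rw [e]
  exact .iUnion fun i => .inter
    (.biInter_finset fun j _ => isSemilinearSet_setOfPred_eq _ _ _ _)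
    (isSemilinearSet_setOf_lt _ _)

/-- A semilinear set of tuples of natural numbers with a semilinear equivalence relation has a
semilinear set of representatives of minimal weight. -/
theorem exists_isSemilinearSet_transversal {k : ℕ} {α : Type*} {Y : Set (Fin k → ℕ)}
    (hY : IsSemilinearSet Y) (w : (Fin k → ℕ) →+ ℕ) (cls : (Fin k → ℕ) → α)
    (hE : IsSemilinearSet {z : (Fin k → ℕ) × (Fin k → ℕ) |
      z.1 ∈ Y ∧ z.2 ∈ Y ∧ cls z.1 = cls z.2}) :
    ∃ R ⊆ Y, IsSemilinearSet R ∧ Set.InjOn cls R ∧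
      ∀ y ∈ Y, ∃ r ∈ R, cls r = cls y ∧ w r ≤ w y := by
  -- With the weight as leading coordinate, a lexicographic minimum has least weight; the remaining
  -- coordinates break ties. Discarding every point with a smaller equivalent one leaves the minima.
  let Ψ : (Fin k → ℕ) →+ (Fin (k + 1) → ℕ) :=
    { toFun := fun y => Fin.cons (w y) y
      map_zero' := by
        ext i
        cases i using Fin.cases <;> simp
      map_add' := fun x y => by
        ext i
        cases i using Fin.cases <;> simp }
  have hΨ : Function.Injective Ψ := fun x y h =>
    funext fun i => congrFun h i.succ
  let E := {z : (Fin k → ℕ) × (Fin k → ℕ) | z.1 ∈ Y ∧ z.2 ∈ Y ∧ cls z.1 = cls z.2}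
  let T := {z : (Fin k → ℕ) × (Fin k → ℕ) | toLex (Ψ.comp (AddMonoidHom.snd _ _) z) <
    toLex (Ψ.comp (AddMonoidHom.fst _ _) z)}
  have hT : IsSemilinearSet T := isSemilinearSet_setOf_toLex_lt _ _
  have hmem : ∀ y, y ∈ Y \ AddMonoidHom.fst _ _ '' (E ∩ T) ↔
      y ∈ Y ∧ ∀ y' ∈ Y, cls y = cls y' → toLex (Ψ y) ≤ toLex (Ψ y') := by
    intro y
    refine and_congr_right fun hy => ?_
    constructor
    · intro h y' hy' hc
      by_contra hlt
      exact h ⟨(y, y'), ⟨⟨hy, hy', hc⟩, not_le.1 hlt⟩, rfl⟩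
    · rintro h ⟨⟨y₁, y'⟩, ⟨⟨-, hy', hc⟩, hlt⟩, rfl⟩
      exact absurd (h y' hy' hc) (not_le.2 hlt)
  refine ⟨Y \ AddMonoidHom.fst _ _ '' (E ∩ T), Set.sdiff_subset,
    hY.sdiff ((hE.inter hT).image _), ?_, ?_⟩
  · intro x hx y hy hxy
    rw [hmem] at hx hy
    exact hΨ (toLex_inj.1 (le_antisymm (hx.2 y hy.1 hxy) (hy.2 x hx.1 hxy.symm)))
  · intro y hy
    obtain ⟨r, ⟨hr, hry⟩, hmin⟩ := (InvImage.wf (fun y => toLex (Ψ y)) wellFounded_lt).has_min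
      {y' | y' ∈ Y ∧ cls y' = cls y} ⟨y, hy, rfl⟩
    refine ⟨r, (hmem r).2 ⟨hr, fun y' hy' hc => ?_⟩, hry, ?_⟩
    · exact not_lt.1 (hmin y' ⟨hy', hc.symm.trans hry⟩)
    · have := Pi.apply_le_of_toLex (i := 0) (not_lt.1 (hmin y ⟨hy, rfl⟩)) (by simp)
      exact this

/-- Every semilinear set is a linear image of a semilinear set of tuples of natural numbers. -/
theorem IsSemilinearSet.exists_eq_image {M : Type*} [AddCommMonoid M] {X : Set M}
    (hX : IsSemilinearSet X) : ∃ (k : ℕ) (f : (Fin k → ℕ) →+ M) (Y : Set (Fin k → ℕ)),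
      IsSemilinearSet Y ∧ X = f '' Y := by
  obtain ⟨P, s, hP, hs, rfl⟩ := hX.exists_fg_eq_subtypeVal
  rw [← AddMonoid.fg_iff_addSubmonoid_fg, AddMonoid.fg_def,
    AddSubmonoid.fg_iff_exists_fin_addMonoidHom] at hP
  obtain ⟨k, f, hf⟩ := hP
  rw [AddMonoidHom.mrange_eq_top] at hf
  refine ⟨k, P.subtype.comp f, f ⁻¹' s, hs.preimage f, ?_⟩
  rw [AddMonoidHom.coe_comp, Set.image_comp, Set.image_preimage_eq _ hf]
  rfl

end Transversal

end WeightedGrowth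

/-! ### Conjugacy and words modulo a normal abelian subgroup -/

namespace WeightedGrowth

open Pointwise
open scoped IsMulCommutative

variable {G : Type*} [Group G]

/-- The element of `G` underlying an element of `A` written additively. -/
def additiveVal {A : Subgroup G} (v : Additive A) : G := (Additive.toMul v : A)

section AdditiveVal

variable {A : Subgroup G}

theorem additiveVal_mem (v : Additive A) : additiveVal v ∈ A := (Additive.toMul v : A).2

theorem additiveVal_injective : Function.Injective (additiveVal : Additive A → G) :=
  fun _ _ h => Subtype.ext h

theorem additiveVal_add (v v' : Additive A) :
    additiveVal (v + v') = additiveVal v * additiveVal v' := rfl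

theorem additiveVal_zero : additiveVal (0 : Additive A) = 1 := rfl

theorem exists_additiveVal_eq {g : G} (hg : g ∈ A) : ∃ v : Additive A, additiveVal v = g :=
  ⟨Additive.ofMul ⟨g, hg⟩, rfl⟩

end AdditiveVal

variable {A : Subgroup G} [A.Normal] [IsMulCommutative A]

/-- Being conjugate by an element of a fixed coset of a normal abelian subgroup is a semilinear
condition on elements of two fixed cosets. -/
theorem isSemilinearSet_setOf_conj {N : Type*} [AddCommMonoid N] [AddMonoid.FG N]
    (α α' : N →+ Additive A) (g t t' : G) :
    IsSemilinearSet {z | ∃ b ∈ A, b * g * (additiveVal (α z) * t) * (b * g)⁻¹ =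
      additiveVal (α' z) * t'} := by
  set s := g * t * g⁻¹ with hs
  by_cases hst : s * t'⁻¹ ∈ A
  · let c : G → Additive A →+ Additive A := fun h =>
      MonoidHom.toAdditive (MulAut.conjNormal h : A ≃* A).toMonoidHom
    have hc : ∀ h v, additiveVal (c h v) = h * additiveVal v * h⁻¹ := fun h v =>
      MulAut.conjNormal_apply h (Additive.toMul v : A)
    -- Moving `b⁻¹` past `s` gives `b * (s * b⁻¹ * s⁻¹)`, which is additive in `b` because `A` is
    -- abelian.
    let δ : Additive A →+ Additive A := AddMonoidHom.id _ - c s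
    have hδ : ∀ v, additiveVal (δ v) = additiveVal v * (s * (additiveVal v)⁻¹ * s⁻¹) := by
      intro v
      have : δ v = v + c s (-v) := by
        simp [δ, sub_eq_add_neg]
      rw [this, additiveVal_add, hc]
      rfl
    obtain ⟨r, hr⟩ := exists_additiveVal_eq hst
    let π := QuotientAddGroup.mk' δ.range
    have hcomm : ∀ u v : Additive A, additiveVal u * additiveVal v = additiveVal v * additiveVal u :=
      fun u v => by rw [← additiveVal_add, add_comm, additiveVal_add]
    have key : ∀ (v u u' : Additive A), additiveVal v * g * (additiveVal u * t) *
        (additiveVal v * g)⁻¹ = additiveVal u' * t' ↔ δ v = -(r + c g u) + u' := by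
      intro v u u'
      have h1 : additiveVal v * g * (additiveVal u * t) * (additiveVal v * g)⁻¹ =
          additiveVal (δ v + c g u + r) * t' := by
        have h2 : additiveVal (δ v + c g u + r) = additiveVal v * additiveVal (c g u) *
            (s * (additiveVal v)⁻¹ * s⁻¹) * (s * t'⁻¹) := by
          have : additiveVal (c g u) * (s * (additiveVal v)⁻¹ * s⁻¹) =
              (s * (additiveVal v)⁻¹ * s⁻¹) * additiveVal (c g u) := by
            have := hcomm (c g u) (c s (-v))
            rwa [hc s] at this
          rw [additiveVal_add, additiveVal_add, hδ, hr, mul_assoc (additiveVal v) (additiveVal _),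
            this]
          simp only [mul_assoc]
        rw [h2, hc, hs]
        group
      rw [h1, mul_left_inj, additiveVal_injective.eq_iff, eq_neg_add_iff_add_eq]
      constructor <;> rintro rfl <;> abel
    -- A suitable `b` exists exactly when both sides agree modulo `δ.range`, a linear equation in
    -- `z`.
    have e : {z | ∃ b ∈ A, b * g * (additiveVal (α z) * t) * (b * g)⁻¹ =
        additiveVal (α' z) * t'} =
        {z | π r + (π.comp ((c g).comp α)) z = 0 + (π.comp α') z} := by
      ext z
      have h : π r + (π.comp ((c g).comp α)) z = 0 + (π.comp α') z ↔
          -(r + c g (α z)) + α' z ∈ δ.range := by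
        rw [← QuotientAddGroup.eq, zero_add]
        rfl
      rw [Set.mem_ofPred_eq, Set.mem_ofPred_eq, h]
      constructor
      · rintro ⟨b, hb, hbz⟩
        obtain ⟨v, rfl⟩ := exists_additiveVal_eq hb
        exact ⟨v, (key _ _ _).1 hbz⟩
      · rintro ⟨v, hv⟩
        exact ⟨additiveVal v, additiveVal_mem v, (key _ _ _).2 hv⟩
    rw [e]
    exact isSemilinearSet_setOfPred_eq _ _ _ _
  · convert IsSemilinearSet.empty
    refine Set.eq_empty_of_forall_notMem ?_
    rintro z ⟨b, hb, h⟩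
    apply hst
    have h' := congrArg (QuotientGroup.mk : G → G ⧸ A) h
    rw [← QuotientGroup.eq_one_iff]
    have h1 := (QuotientGroup.eq_one_iff b).2 hb
    have h2 := (QuotientGroup.eq_one_iff _).2 (additiveVal_mem (α z))
    have h3 := (QuotientGroup.eq_one_iff _).2 (additiveVal_mem (α' z))
    simp only [QuotientGroup.mk_mul, QuotientGroup.mk_inv, h1, h2, h3, one_mul] at h'
    rw [hs, QuotientGroup.mk_mul, QuotientGroup.mk_inv, ← h']
    simp

variable {S : Finset G}

theorem wordEval_append (u v : List S) : wordEval (u ++ v) = wordEval u * wordEval v := by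
  simp [wordEval]

theorem wordWeight_append {G : Type*} {S : Finset G} (ω : S → ℕ) (u v : List S) :
    wordWeight ω (u ++ v) = wordWeight ω u + wordWeight ω v := by
  simp [wordWeight]

/-- The elements of a fixed coset, paired with the weights of the words representing them, form a
semilinear set. -/
theorem isSemilinearSet_wordEval_coset [A.FiniteIndex] (ω : S → ℕ) (x : G ⧸ A → G)
    (hx : ∀ q, (x q : G ⧸ A) = q) (hx1 : x 1 = 1) (q : G ⧸ A) :
    IsSemilinearSet {m : Additive A × ℕ | ∃ w : List S,
      wordEval w = additiveVal m.1 * x q ∧ wordWeight ω w = m.2} := by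
  have := Fintype.ofFinite (G ⧸ A)
  -- The labels `x p * s * (x q)⁻¹` telescope along a path from `1`, because `x 1 = 1`.
  let d : G ⧸ A → G ⧸ A → Set (Additive A × ℕ) := fun p q =>
    {m | ∃ s : S, p * ((s : G) : G ⧸ A) = q ∧ additiveVal m.1 = x p * s * (x q)⁻¹ ∧ m.2 = ω s}
  have hd : ∀ p q, IsSemilinearSet (d p q) := by
    intro p q
    refine .of_finite ((Set.finite_iUnion (f := fun s : S => {m : Additive A × ℕ |
      additiveVal m.1 = x p * s * (x q)⁻¹ ∧ m.2 = ω s}) fun s => ?_).subset ?_)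
    · refine Set.Subsingleton.finite fun m hm m' hm' => Prod.ext ?_ (hm.2.trans hm'.2.symm)
      exact additiveVal_injective (hm.1.trans hm'.1.symm)
    · rintro m ⟨s, -, hs⟩
      exact Set.mem_iUnion.2 ⟨s, hs⟩
  have hof : ∀ q m, PathLabel d Finset.univ 1 q m →
      ∃ w : List S, wordEval w = additiveVal m.1 * x q ∧ wordWeight ω w = m.2 := by
    intro q m h
    induction h with
    | single he =>
      obtain ⟨s, -, h1, h2⟩ := he
      exact ⟨[s], by simp [h1, hx1, wordEval], by simp [wordWeight, h2]⟩
    | @step q r m e _ _ he ih =>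
      obtain ⟨s, -, h1, h2⟩ := he
      obtain ⟨w, hw1, hw2⟩ := ih
      refine ⟨w ++ [s], ?_, ?_⟩
      · rw [wordEval_append, hw1, Prod.fst_add, additiveVal_add, h1]
        simp [wordEval, mul_assoc]
      · rw [wordWeight_append, hw2, Prod.snd_add, h2]
        simp [wordWeight]
  have hto : ∀ w : List S, w ≠ [] → ∀ q m, wordEval w = additiveVal m.1 * x q →
      wordWeight ω w = m.2 → PathLabel d Finset.univ 1 q m := by
    intro w
    induction w using List.reverseRecOn with
    | nil => simp
    | append_singleton l s ih =>
      intro _ q m h1 h2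
      rw [wordEval_append] at h1
      rw [wordWeight_append] at h2
      have e1 : wordEval [s] = (s : G) := by simp [wordEval]
      have e2 : wordWeight ω [s] = ω s := by simp [wordWeight]
      rw [e1] at h1
      rw [e2] at h2
      let p : G ⧸ A := (wordEval l : G)
      have hq : p * ((s : G) : G ⧸ A) = q := by
        have := congrArg (QuotientGroup.mk : G → G ⧸ A) h1
        rwa [QuotientGroup.mk_mul, QuotientGroup.mk_mul,
          (QuotientGroup.eq_one_iff _).2 (additiveVal_mem m.1), one_mul, hx] at this
      have hmem : ∀ {g h : G}, (g : G ⧸ A) = h → g * h⁻¹ ∈ A := fun {g h} hgh => by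
        rw [← QuotientGroup.eq_one_iff, QuotientGroup.mk_mul, QuotientGroup.mk_inv, hgh,
          mul_inv_cancel]
      obtain ⟨v, hv⟩ := exists_additiveVal_eq (hmem (hx p).symm)
      obtain ⟨v', hv'⟩ := exists_additiveVal_eq (A := A) (g := x p * s * (x q)⁻¹)
        (hmem (by rw [QuotientGroup.mk_mul, hx, hx, hq]))
      have he : (v', ω s) ∈ d p q := ⟨s, hq, hv', rfl⟩
      have hm : m = (v, wordWeight ω l) + (v', ω s) := by
        refine Prod.ext (additiveVal_injective ?_) h2.symm
        rw [Prod.fst_add, additiveVal_add, hv, hv']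
        rw [← mul_inv_eq_iff_eq_mul] at h1
        rw [← h1]
        group
      rw [hm]
      by_cases hl : l = []
      · subst hl
        have hp : p = 1 := by simp [p, wordEval]
        have hv0 : v = 0 := additiveVal_injective (by
          rw [hv, hp, hx1, additiveVal_zero]
          simp [wordEval])
        rw [hv0, show ((0 : Additive A), wordWeight ω ([] : List S)) = 0 from rfl, zero_add]
        rw [hp] at he
        exact .single he
      · exact .step (ih hl p (v, wordWeight ω l) (by rw [hv]; group) rfl) (Finset.mem_univ _) he
  -- `PathLabel` only sees nonempty paths; the empty word adds the point `0` in the trivial coset.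
  have e : {m : Additive A × ℕ | ∃ w : List S,
      wordEval w = additiveVal m.1 * x q ∧ wordWeight ω w = m.2} =
      {m | PathLabel d Finset.univ 1 q m} ∪ {m | m = 0 ∧ q = 1} := by
    ext m
    constructor
    · rintro ⟨w, h1, h2⟩
      by_cases hw : w = []
      · right
        subst hw
        have h1' : 1 = additiveVal m.1 * x q := by simpa [wordEval] using h1
        have hq : q = 1 := by
          have := congrArg (QuotientGroup.mk : G → G ⧸ A) h1'
          rw [QuotientGroup.mk_mul, (QuotientGroup.eq_one_iff _).2 (additiveVal_mem m.1), one_mul,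
            hx] at this
          exact this.symm
        refine ⟨Prod.ext (additiveVal_injective ?_) (by simpa [wordWeight] using h2.symm), hq⟩
        rw [hq, hx1, mul_one] at h1'
        exact h1'.symm
      · exact .inl (hto w hw q m h1 h2)
    · rintro (h | ⟨rfl, rfl⟩)
      · exact hof q m h
      · exact ⟨[], by simp [wordEval, hx1, additiveVal_zero], by simp [wordWeight]⟩
  rw [e]
  exact (isSemilinearSet_pathLabel hd _ _ _).union
    (.of_finite ((Set.finite_singleton 0).subset fun m hm => hm.1))

end WeightedGrowth

/-! ### Rationality of the conjugacy growth series -/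

namespace WeightedGrowth

open Pointwise
open scoped IsMulCommutative

variable {G : Type*} [Group G] {S : Finset G}

theorem classWeight_mk_wordEval_le (ω : S → ℕ) (w : List S) :
    classWeight ω (ConjClasses.mk (wordEval w)) ≤ wordWeight ω w :=
  le_trans (Nat.sInf_le ⟨_, ConjClasses.mem_carrier_mk, rfl⟩) (Nat.sInf_le ⟨w, rfl, rfl⟩)

/-- The conjugacy growth series is rational as soon as words can be parametrized by a semilinear
set of tuples of natural numbers, with linear weight and a semilinear conjugacy relation. -/
theorem isRationalSeries_conjGrowthSeries_of_parametrization
    (hS : Submonoid.closure (S : Set G) = ⊤) (ω : S → ℕ) (hω : ∀ s, 0 < ω s) {k : ℕ}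
    {Y : Set (Fin k → ℕ)} (hY : IsSemilinearSet Y) (w : (Fin k → ℕ) →+ ℕ) (ev : (Fin k → ℕ) → G)
    (hword : ∀ y ∈ Y, ∃ v : List S, wordEval v = ev y ∧ wordWeight ω v = w y)
    (hpoint : ∀ v : List S, ∃ y ∈ Y, wordEval v = ev y ∧ wordWeight ω v = w y)
    (hE : IsSemilinearSet {z : (Fin k → ℕ) × (Fin k → ℕ) |
      z.1 ∈ Y ∧ z.2 ∈ Y ∧ ConjClasses.mk (ev z.1) = ConjClasses.mk (ev z.2)}) :
    IsRationalSeries (conjGrowthSeries ω) := by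
  obtain ⟨R, hRY, hR, hinj, hmin⟩ :=
    exists_isSemilinearSet_transversal hY w (fun y => ConjClasses.mk (ev y)) hE
  have hrep : ∀ c : ConjClasses G, ∃ r ∈ R, ConjClasses.mk (ev r) = c ∧ w r ≤ classWeight ω c := by
    intro c
    obtain ⟨v, hv, hvw⟩ := exists_word_classWeight hS ω c
    obtain ⟨y, hy, hye, hyw⟩ := hpoint v
    obtain ⟨r, hr, hrc, hrw⟩ := hmin y hy
    exact ⟨r, hr, by rw [hrc, ← hye, hv], by rw [← hvw, hyw]; exact hrw⟩
  have hweight : ∀ r ∈ R, classWeight ω (ConjClasses.mk (ev r)) = w r := by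
    intro r hr
    refine le_antisymm ?_ ?_
    · obtain ⟨v, hv, hvw⟩ := hword r (hRY hr)
      rw [← hv, ← hvw]
      exact classWeight_mk_wordEval_le ω v
    -- The representative `r'` attaining the bound is `r` itself, as `R` meets each class once.
    · obtain ⟨r', hr', hc, hle⟩ := hrep (ConjClasses.mk (ev r))
      rwa [hinj hr' hr hc] at hle
  have himage : (fun y => ConjClasses.mk (ev y)) '' R = Set.univ :=
    Set.eq_univ_of_forall fun c => by
      obtain ⟨r, hr, hc, -⟩ := hrep c
      exact ⟨r, hr, hc⟩
  have hseries : conjGrowthSeries ω = countSeries (classWeight ω) Set.univ := by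
    ext n
    simp [conjGrowthSeries, conjGrowth, countSeries]
  have hcongr : ∀ n, {r | r ∈ R ∧ (classWeight ω ∘ fun y => ConjClasses.mk (ev y)) r = n} =
      {r | r ∈ R ∧ w r = n} := fun n => Set.ext fun r => and_congr_right fun hr => by
    rw [Function.comp_apply, hweight r hr]
  have hcount : conjGrowthSeries ω = countSeries w R := by
    rw [hseries, ← himage, countSeries_image hinj]
    ext n
    simp only [countSeries, hcongr]
  rw [hcount]
  refine isRationalSeries_countSeries_of_isSemilinearSet hR w fun n => ?_
  rw [← hcongr n]
  refine HasFiniteFibers.of_image hinj ?_ n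
  exact fun n => (finite_classWeight_eq hS ω hω n).subset fun c hc => hc.2

theorem isRationalSeries_conjGrowthSeries_of_normal {A : Subgroup G} [A.Normal]
    [IsMulCommutative A] [A.FiniteIndex] (hS : Submonoid.closure (S : Set G) = ⊤) (ω : S → ℕ)
    (hω : ∀ s, 0 < ω s) : IsRationalSeries (conjGrowthSeries ω) := by
  classical
  obtain ⟨x, hx, hx1⟩ : ∃ x : G ⧸ A → G, (∀ q, (x q : G ⧸ A) = q) ∧ x 1 = 1 := by
    refine ⟨Function.update Quotient.out 1 1, fun q => ?_, by simp⟩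
    by_cases hq : q = 1
    · subst hq
      simp
    · rw [Function.update_of_ne hq]
      exact Quotient.out_eq' q
  let W : G ⧸ A → Set (Additive A × ℕ) := fun q => {m | ∃ w : List S,
    wordEval w = additiveVal m.1 * x q ∧ wordWeight ω w = m.2}
  -- Tagging by a basis vector records the coset inside a commutative monoid, so that one semilinear
  -- set holds all cosets.
  let ε : G ⧸ A → (G ⧸ A → ℕ) := fun q => Pi.single q 1
  have hε : Function.Injective ε := fun p q h => by
    by_contra hpq
    have := congrFun h p
    simp [ε, hpq] at this
  let X : Set ((Additive A × ℕ) × (G ⧸ A → ℕ)) :=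
    ⋃ q, ((0, ε q) : (Additive A × ℕ) × (G ⧸ A → ℕ)) +ᵥ
      (AddMonoidHom.inl (Additive A × ℕ) (G ⧸ A → ℕ) '' W q)
  have hX : IsSemilinearSet X := .iUnion fun q =>
    ((isSemilinearSet_wordEval_coset ω x hx hx1 q).image _).vadd _
  have hmemX : ∀ m, m ∈ X ↔ ∃ q, m.2 = ε q ∧ m.1 ∈ W q := by
    rintro ⟨m, v⟩
    simp only [X, Set.mem_iUnion, Set.mem_vadd_set, Set.mem_image]
    refine exists_congr fun q => ?_
    constructor
    · rintro ⟨_, ⟨m', hm', rfl⟩, h⟩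
      simp only [AddMonoidHom.inl_apply, vadd_eq_add, Prod.mk_add_mk, zero_add, add_zero,
        Prod.mk.injEq] at h
      exact ⟨h.2.symm, h.1 ▸ hm'⟩
    · rintro ⟨rfl, hm⟩
      exact ⟨_, ⟨m, hm, rfl⟩, by simp⟩
  obtain ⟨k, f, Y, hY, hXY⟩ := IsSemilinearSet.exists_eq_image hX
  let pos : (Fin k → ℕ) → G ⧸ A := fun y => Function.invFun ε (f y).2
  have hpos : ∀ y q, (f y).2 = ε q → pos y = q := fun y q h => by
    simp only [pos, h]
    exact Function.leftInverse_invFun hε q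
  have hYX : ∀ y ∈ Y, (f y).2 = ε (pos y) ∧ (f y).1 ∈ W (pos y) := by
    intro y hy
    have : f y ∈ X := hXY ▸ Set.mem_image_of_mem f hy
    obtain ⟨q, hq, hW⟩ := (hmemX _).1 this
    rw [hpos y q hq]
    exact ⟨hq, hW⟩
  let a : (Fin k → ℕ) →+ Additive A :=
    (AddMonoidHom.fst _ _).comp ((AddMonoidHom.fst _ _).comp f)
  let w : (Fin k → ℕ) →+ ℕ := (AddMonoidHom.snd _ _).comp ((AddMonoidHom.fst _ _).comp f)
  let c : (Fin k → ℕ) →+ (G ⧸ A → ℕ) := (AddMonoidHom.snd _ _).comp f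
  refine isRationalSeries_conjGrowthSeries_of_parametrization hS ω hω hY w
    (fun y => additiveVal (a y) * x (pos y)) (fun y hy => (hYX y hy).2) (fun v => ?_) ?_
  · have hmem : wordEval v * (x (wordEval v : G))⁻¹ ∈ A := by
      rw [← QuotientGroup.eq_one_iff, QuotientGroup.mk_mul, QuotientGroup.mk_inv, hx,
        mul_inv_cancel]
    obtain ⟨u, hu⟩ := exists_additiveVal_eq hmem
    have hm : ((u, wordWeight ω v), ε (wordEval v : G)) ∈ X :=
      (hmemX _).2 ⟨_, rfl, v, by simp [hu], rfl⟩
    rw [hXY] at hm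
    obtain ⟨y, hy, hfy⟩ := hm
    refine ⟨y, hy, ?_, ?_⟩
    · have h1 : a y = u := by simp [a, hfy]
      have h2 : pos y = (wordEval v : G) := hpos y _ (by rw [hfy])
      rw [h1, h2, hu]
      simp
    · simp [w, hfy]
  -- For fixed cosets of both elements and of the conjugator, the relation is the semilinear one
  -- treated above; finitely many such triples occur.
  · have e : {z : (Fin k → ℕ) × (Fin k → ℕ) | z.1 ∈ Y ∧ z.2 ∈ Y ∧
        ConjClasses.mk (additiveVal (a z.1) * x (pos z.1)) =
          ConjClasses.mk (additiveVal (a z.2) * x (pos z.2))} =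
        ⋃ q, ⋃ q', ⋃ u : G ⧸ A, (AddMonoidHom.fst _ _ ⁻¹' (Y ∩ c ⁻¹' {ε q})) ∩
          ((AddMonoidHom.snd _ _ ⁻¹' (Y ∩ c ⁻¹' {ε q'})) ∩
          {z | ∃ b ∈ A, b * x u * (additiveVal (a.comp (AddMonoidHom.fst _ _) z) * x q) *
            (b * x u)⁻¹ = additiveVal (a.comp (AddMonoidHom.snd _ _) z) * x q'}) := by
      ext ⟨y, y'⟩
      simp only [Set.mem_iUnion]
      constructor
      · rintro ⟨hy, hy', h⟩
        obtain ⟨g, hg⟩ := isConj_iff.1 (ConjClasses.mk_eq_mk_iff_isConj.1 h)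
        refine ⟨pos y, pos y', (g : G ⧸ A), ⟨hy, (hYX y hy).1⟩, ⟨hy', (hYX y' hy').1⟩,
          g * (x (g : G ⧸ A))⁻¹, ?_, ?_⟩
        · rw [← QuotientGroup.eq_one_iff, QuotientGroup.mk_mul, QuotientGroup.mk_inv, hx,
            mul_inv_cancel]
        · rw [inv_mul_cancel_right]
          exact hg
      · rintro ⟨q, q', u, ⟨hy, hq⟩, ⟨hy', hq'⟩, b, -, h⟩
        refine ⟨hy, hy', ConjClasses.mk_eq_mk_iff_isConj.2 (isConj_iff.2 ⟨b * x u, ?_⟩)⟩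
        rw [hpos y q hq, hpos y' q' hq']
        exact h
    rw [e]
    have hYq : ∀ q, IsSemilinearSet (Y ∩ c ⁻¹' {ε q}) := fun q =>
      hY.inter ((IsSemilinearSet.singleton _).preimage c)
    exact .iUnion fun q => .iUnion fun q' => .iUnion fun u =>
      ((hYq q).preimage _).inter (((hYq q').preimage _).inter (isSemilinearSet_setOf_conj _ _ _ _ _))

end WeightedGrowth

theorem theoremC {G : Type*} [Group G] (hG : IsVirtuallyAbelian G)
    (S : Finset G) (hS : Submonoid.closure (S : Set G) = ⊤)
    (ω : S → ℕ) (hω : ∀ s : S, 0 < ω s) :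
    WeightedGrowth.IsRationalSeries (WeightedGrowth.conjGrowthSeries ω) := by
  obtain ⟨H, hH, hfin⟩ := hG
  -- The normal core inherits commutativity from `H` and still has finite index.
  have : IsMulCommutative H.normalCore := ⟨⟨fun a b => Subtype.ext <|
    congrArg (Subtype.val : H → G)
      (hH.is_comm.comm ⟨a, H.normalCore_le a.2⟩ ⟨b, H.normalCore_le b.2⟩)⟩⟩
  exact WeightedGrowth.isRationalSeries_conjGrowthSeries_of_normal (A := H.normalCore) hS ω hω
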